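/- Let $1<p<\infty$, let $N,m\ge 0$ be integers, and let the scalar field be $\mathbb R$ or $\mathbb C$. Let $W^{m,p}(\mathbb R^N)$ be the space of all $u\in L^p(\mathbb R^N)$ whose distributional derivatives $\partial^\alpha u$, $|\alpha|\le m$, belong to $L^p(\mathbb R^N)$, with the norm $\|u\|_{W^{m,p}}=\bigl(\sum_{|\alpha|\le m}\|\partial^\alpha u\|_{L^p}^p\bigr)^{1/p}$. For $y\in\mathbb Z^N$ let $g[y]u=u(\cdot-y)$, and let $G[\mathbb Z^N]=\{g[y]: y\in\mathbb Z^N\}$, regarded as a set of bounded operators on $W^{m,p}(\mathbb R^N)$. Bounded operators $A_n$ on a normed space $X$ converge operator-strongly (operator-weakly) to $A$ if $A_nu\to Au$ in norm (weakly) for every $u\in X$. A pair $(X,G)$ is called a dislocation space if $X$ is a Banach space, $G$ is a group, under composition, of bounded linear operators on $X$ that are bijective isometries, and 1. every sequence $(g_n)$ in $G$ that does not converge operator-weakly to $0$ has a subsequence that converges operator-strongly to some bounded operator on $X$; 2. for every sequence $(g_n)$ in $G$ that does not converge operator-weakly to $0$ and every sequence $(u_n)$ in $X$ with $u_n\to 0$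 weakly, there is a subsequence $(n_j)$ such that $g_{n_j}u_{n_j}\to 0$ weakly in $X$. **Proposition.** $(W^{m,p}(\mathbb R^N),G[\mathbb Z^N])$ is a dislocation space. Moreover, for every sequence $(y_n)$ in $\mathbb Z^N$ such that $(g[y_n])$ does not converge operator-weakly to $0$ on $W^{m,p}(\mathbb R^N)$, there are a subsequence $(n_j)$ and $z\in\mathbb Z^N$ such that $g[y_{n_j}]\to g[z]$ operator-strongly on $W^{m,p}(\mathbb R^N)$ and the Banach space adjoints satisfy $g[y_{n_j}]^*\to g[z]^*$ operator-strongly on the dual space $(W^{m,p}(\mathbb R^N))^*$. -/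

import Mathlib

open MeasureTheory Filter Topology
open scoped ENNReal ContDiff

noncomputable section

section AbstractTheory

variable {𝕜 X : Type*} [RCLike 𝕜] [NormedAddCommGroup X] [NormedSpace 𝕜 X]

variable (𝕜) in
/-- Weak convergence of a sequence `u n` to `x` in the normed space `X`. -/
def WeaklyTendsto (u : ℕ → X) (x : X) : Prop :=
  ∀ φ : StrongDual 𝕜 X, Tendsto (fun n => φ (u n)) atTop (𝓝 (φ x))

/-- Operator-strong convergence of bounded operators. -/
def OpStronglyTendsto (A : ℕ → X →L[𝕜] X) (B : X →L[𝕜] X) : Prop :=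
  ∀ u : X, Tendsto (fun n => A n u) atTop (𝓝 (B u))

/-- Operator-weak convergence of bounded operators. -/
def OpWeaklyTendsto (A : ℕ → X →L[𝕜] X) (B : X →L[𝕜] X) : Prop :=
  ∀ u : X, WeaklyTendsto 𝕜 (fun n => A n u) (B u)

/-- The Banach space adjoint `T* : X* → X*`, `T* φ = φ ∘ T`. -/
def dualAdjoint (T : X →L[𝕜] X) : StrongDual 𝕜 X →L[𝕜] StrongDual 𝕜 X :=
  (ContinuousLinearMap.compL 𝕜 X X 𝕜).flip T

theorem dualAdjoint_apply (T : X →L[𝕜] X) (φ : StrongDual 𝕜 X) (u : X) :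
    dualAdjoint T φ u = φ (T u) := rfl

/-- `G ⊆ B(X)` is a group, under composition, of bijective isometries of `X`. -/
structure IsIsometryGroup (G : Set (X →L[𝕜] X)) : Prop where
  one_mem : ContinuousLinearMap.id 𝕜 X ∈ G
  comp_mem : ∀ g ∈ G, ∀ h ∈ G, g.comp h ∈ G
  exists_inv : ∀ g ∈ G, ∃ h ∈ G,
    g.comp h = ContinuousLinearMap.id 𝕜 X ∧ h.comp g = ContinuousLinearMap.id 𝕜 X
  isometry : ∀ g ∈ G, Isometry g
  bijective : ∀ g ∈ G, Function.Bijective g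

/-- `(X, G)` is a dislocation space: `X` is a Banach space and `G ⊆ B(X)` is a dislocation
group. -/
structure IsDislocationSpace (G : Set (X →L[𝕜] X)) : Prop where
  complete : CompleteSpace X
  isIsometryGroup : IsIsometryGroup G
  exists_strong_limit : ∀ g : ℕ → X →L[𝕜] X, (∀ n, g n ∈ G) → ¬ OpWeaklyTendsto g 0 →
    ∃ k : ℕ → ℕ, StrictMono k ∧ ∃ A : X →L[𝕜] X, OpStronglyTendsto (fun j => g (k j)) A
  exists_weak_null : ∀ g : ℕ → X →L[𝕜] X, (∀ n, g n ∈ G) → ¬ OpWeaklyTendsto g 0 →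
    ∀ u : ℕ → X, WeaklyTendsto 𝕜 u 0 →
      ∃ k : ℕ → ℕ, StrictMono k ∧ WeaklyTendsto 𝕜 (fun j => g (k j) (u (k j))) 0

end AbstractTheory

section Sobolev

/-- The partial derivative `∂φ/∂xᵢ`. -/
def partialDeriv {N : ℕ} (i : Fin N) (φ : EuclideanSpace ℝ (Fin N) → ℝ) :
    EuclideanSpace ℝ (Fin N) → ℝ :=
  fun x => fderiv ℝ φ x (EuclideanSpace.single i 1)

/-- The classical derivative `∂^α φ = ∂₁^{α₁} ⋯ ∂_N^{α_N} φ`. -/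
def multiDeriv {N : ℕ} (α : Fin N → ℕ) (φ : EuclideanSpace ℝ (Fin N) → ℝ) :
    EuclideanSpace ℝ (Fin N) → ℝ :=
  (List.finRange N).foldr (fun i f => (partialDeriv i)^[α i] f) φ

/-- The multi-indices `α ∈ ℕ^N` with `|α| ≤ m`. -/
def multiIndices (N m : ℕ) : Finset (Fin N → ℕ) :=
  (Fintype.piFinset fun _ => Finset.range (m + 1)).filter fun α => ∑ i, α i ≤ m

theorem mem_multiIndices {N m : ℕ} {α : Fin N → ℕ} :
    α ∈ multiIndices N m ↔ ∑ i, α i ≤ m := by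
  simp only [multiIndices, Finset.mem_filter, Fintype.mem_piFinset, Finset.mem_range,
    and_iff_right_iff_imp]
  intro h i
  have := Finset.single_le_sum (f := α) (fun _ _ => Nat.zero_le _) (Finset.mem_univ i)
  omega

/-- `φ` is a test function on `ℝ^N`. -/
def IsTestFunction {N : ℕ} (φ : EuclideanSpace ℝ (Fin N) → ℝ) : Prop :=
  ContDiff ℝ ∞ φ ∧ HasCompactSupport φ

theorem IsTestFunction.partialDeriv {N : ℕ} {φ : EuclideanSpace ℝ (Fin N) → ℝ}
    (h : IsTestFunction φ) (i : Fin N) : IsTestFunction (partialDeriv i φ) :=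
  ⟨(h.1.fderiv_right (m := ∞) (by simp)).clm_apply contDiff_const,
    h.2.fderiv_apply (𝕜 := ℝ) _⟩

theorem IsTestFunction.multiDeriv {N : ℕ} {φ : EuclideanSpace ℝ (Fin N) → ℝ}
    (h : IsTestFunction φ) (α : Fin N → ℕ) : IsTestFunction (multiDeriv α φ) := by
  unfold _root_.multiDeriv
  induction List.finRange N with
  | nil => exact h
  | cons i l ih =>
    simp only [List.foldr_cons]
    induction α i with
    | zero => exact ih
    | succ k ihk => rw [Function.iterate_succ_apply']; exact ihk.partialDeriv i

theorem multiDeriv_zero {N : ℕ} (φ : EuclideanSpace ℝ (Fin N) → ℝ) : multiDeriv 0 φ = φ := by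
  unfold multiDeriv
  induction List.finRange N with
  | nil => rfl
  | cons i l ih => exact ih

theorem multiDeriv_comp_add {N : ℕ} (α : Fin N → ℕ) (φ : EuclideanSpace ℝ (Fin N) → ℝ)
    (a : EuclideanSpace ℝ (Fin N)) :
    multiDeriv α (fun x => φ (x + a)) = fun x => multiDeriv α φ (x + a) := by
  unfold multiDeriv
  induction List.finRange N with
  | nil => rfl
  | cons i l ih =>
    simp only [List.foldr_cons]
    rw [ih]
    induction α i with
    | zero => rfl
    | succ k ihk =>
      rw [Function.iterate_succ_apply', Function.iterate_succ_apply', ihk]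
      funext x
      simp only [partialDeriv, fderiv_comp_add_right]

variable {𝕜 : Type*} [RCLike 𝕜] {N : ℕ} {p : ℝ≥0∞} [Fact (1 ≤ p)]

/-- `v` is the distributional derivative `∂^α u`, both being elements of `L^p(ℝ^N)`. -/
def IsWeakDeriv (α : Fin N → ℕ)
    (u v : Lp 𝕜 p (volume : Measure (EuclideanSpace ℝ (Fin N)))) : Prop :=
  ∀ φ : EuclideanSpace ℝ (Fin N) → ℝ, IsTestFunction φ →
    ∫ x, multiDeriv α φ x • u x = (-1) ^ (∑ i, α i) * ∫ x, φ x • v x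

theorem IsTestFunction.integrable_smul {φ : EuclideanSpace ℝ (Fin N) → ℝ} (h : IsTestFunction φ)
    (u : Lp 𝕜 p (volume : Measure (EuclideanSpace ℝ (Fin N)))) :
    Integrable (fun x => φ x • u x) :=
  ((Lp.memLp u).locallyIntegrable Fact.out).integrable_smul_left_of_hasCompactSupport
    h.1.continuous h.2

theorem isWeakDeriv_zero_self (u : Lp 𝕜 p (volume : Measure (EuclideanSpace ℝ (Fin N)))) :
    IsWeakDeriv 0 u u := by
  intro φ _
  simp [multiDeriv_zero]

theorem IsWeakDeriv.unique {α : Fin N → ℕ}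
    {u v w : Lp 𝕜 p (volume : Measure (EuclideanSpace ℝ (Fin N)))}
    (hv : IsWeakDeriv α u v) (hw : IsWeakDeriv α u w) : v = w := by
  refine Lp.ext (ae_eq_of_integral_contDiff_smul_eq
    ((Lp.memLp v).locallyIntegrable Fact.out) ((Lp.memLp w).locallyIntegrable Fact.out) ?_)
  intro φ h1 h2
  have h := (hv φ ⟨h1, h2⟩).symm.trans (hw φ ⟨h1, h2⟩)
  exact mul_left_cancel₀ (pow_ne_zero _ (neg_ne_zero.mpr one_ne_zero)) h

theorem IsWeakDeriv.add {α : Fin N → ℕ}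
    {u v u' v' : Lp 𝕜 p (volume : Measure (EuclideanSpace ℝ (Fin N)))}
    (h : IsWeakDeriv α u v) (h' : IsWeakDeriv α u' v') : IsWeakDeriv α (u + u') (v + v') := by
  have key : ∀ (a b : Lp 𝕜 p (volume : Measure (EuclideanSpace ℝ (Fin N))))
      (ψ : EuclideanSpace ℝ (Fin N) → ℝ), IsTestFunction ψ →
      ∫ x, ψ x • (a + b : Lp 𝕜 p volume) x = (∫ x, ψ x • a x) + ∫ x, ψ x • b x := by
    intro a b ψ hψ
    rw [← integral_add (hψ.integrable_smul a) (hψ.integrable_smul b)]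
    refine integral_congr_ae ?_
    filter_upwards [Lp.coeFn_add a b] with x hx
    rw [hx, Pi.add_apply, smul_add]
  intro φ hφ
  rw [key _ _ _ (hφ.multiDeriv α), key _ _ _ hφ, h φ hφ, h' φ hφ, mul_add]

theorem IsWeakDeriv.smul {α : Fin N → ℕ}
    {u v : Lp 𝕜 p (volume : Measure (EuclideanSpace ℝ (Fin N)))}
    (h : IsWeakDeriv α u v) (c : 𝕜) : IsWeakDeriv α (c • u) (c • v) := by
  have key : ∀ (a : Lp 𝕜 p (volume : Measure (EuclideanSpace ℝ (Fin N))))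
      (ψ : EuclideanSpace ℝ (Fin N) → ℝ),
      ∫ x, ψ x • (c • a : Lp 𝕜 p volume) x = c * ∫ x, ψ x • a x := by
    intro a ψ
    rw [← integral_const_mul]
    refine integral_congr_ae ?_
    filter_upwards [Lp.coeFn_smul c a] with x hx
    simp [hx]
  intro φ hφ
  rw [key, key, h φ hφ, mul_left_comm]

theorem isWeakDeriv_zero_zero (α : Fin N → ℕ) :
    IsWeakDeriv α (0 : Lp 𝕜 p (volume : Measure (EuclideanSpace ℝ (Fin N)))) 0 := by
  have key : ∀ ψ : EuclideanSpace ℝ (Fin N) → ℝ,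
      ∫ x, ψ x • (0 : Lp 𝕜 p (volume : Measure (EuclideanSpace ℝ (Fin N)))) x = 0 := by
    intro ψ
    rw [← integral_zero (EuclideanSpace ℝ (Fin N)) 𝕜]
    refine integral_congr_ae ?_
    filter_upwards [Lp.coeFn_zero 𝕜 p (volume : Measure (EuclideanSpace ℝ (Fin N)))] with x hx
    rw [hx, Pi.zero_apply, smul_zero]
  intro φ _
  rw [key, key, mul_zero]

variable (𝕜 N p) in
/-- `W^{m,p}(ℝ^N)` as a subspace of `L^p(ℝ^N)`: the functions all of whose distributional
derivatives of order at most `m` belong to `L^p(ℝ^N)`. -/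
def sobolevSubmodule (m : ℕ) :
    Submodule 𝕜 (Lp 𝕜 p (volume : Measure (EuclideanSpace ℝ (Fin N)))) where
  carrier := {u | ∀ α : Fin N → ℕ, ∑ i, α i ≤ m → ∃ v, IsWeakDeriv α u v}
  add_mem' := fun hu hu' α hα => by
    obtain ⟨v, hv⟩ := hu α hα
    obtain ⟨v', hv'⟩ := hu' α hα
    exact ⟨v + v', hv.add hv'⟩
  zero_mem' := fun α _ => ⟨0, isWeakDeriv_zero_zero α⟩
  smul_mem' := fun c u hu α hα => by
    obtain ⟨v, hv⟩ := hu α hα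
    exact ⟨c • v, hv.smul c⟩

variable (𝕜 N p) in
/-- The Sobolev space `W^{m,p}(ℝ^N)`. It carries the Sobolev norm defined below, not the norm
of `L^p(ℝ^N)`. -/
def SobolevSpace (m : ℕ) : Type _ := sobolevSubmodule 𝕜 N p m

namespace SobolevSpace

variable {m : ℕ}

instance : AddCommGroup (SobolevSpace 𝕜 N p m) :=
  inferInstanceAs (AddCommGroup (sobolevSubmodule 𝕜 N p m))

instance : Module 𝕜 (SobolevSpace 𝕜 N p m) :=
  inferInstanceAs (Module 𝕜 (sobolevSubmodule 𝕜 N p m))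

/-- The inclusion of `W^{m,p}(ℝ^N)` in `L^p(ℝ^N)`. -/
def toLp : SobolevSpace 𝕜 N p m →ₗ[𝕜] Lp 𝕜 p (volume : Measure (EuclideanSpace ℝ (Fin N))) :=
  (sobolevSubmodule 𝕜 N p m).subtype

theorem toLp_injective : Function.Injective (toLp : SobolevSpace 𝕜 N p m →ₗ[𝕜] _) :=
  Subtype.val_injective

theorem toLp_mem (u : SobolevSpace 𝕜 N p m) : toLp u ∈ sobolevSubmodule 𝕜 N p m :=
  Subtype.property (p := fun v => v ∈ sobolevSubmodule 𝕜 N p m) u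

/-- An element of `L^p(ℝ^N)` with all its derivatives in `L^p(ℝ^N)`, as an element of
`W^{m,p}(ℝ^N)`. -/
def ofLp (u : Lp 𝕜 p (volume : Measure (EuclideanSpace ℝ (Fin N))))
    (hu : u ∈ sobolevSubmodule 𝕜 N p m) : SobolevSpace 𝕜 N p m :=
  Subtype.mk (p := fun v => v ∈ sobolevSubmodule 𝕜 N p m) u hu

theorem toLp_ofLp (u : Lp 𝕜 p (volume : Measure (EuclideanSpace ℝ (Fin N))))
    (hu : u ∈ sobolevSubmodule 𝕜 N p m) : toLp (ofLp u hu) = u := rfl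

theorem exists_weakDeriv (u : SobolevSpace 𝕜 N p m) (α : multiIndices N m) :
    ∃ v, IsWeakDeriv α.1 (toLp u) v :=
  toLp_mem u α.1 (mem_multiIndices.mp α.2)

/-- The distributional derivative `∂^α : W^{m,p}(ℝ^N) → L^p(ℝ^N)`, `|α| ≤ m`. -/
def weakDeriv (α : multiIndices N m) :
    SobolevSpace 𝕜 N p m →ₗ[𝕜] Lp 𝕜 p (volume : Measure (EuclideanSpace ℝ (Fin N))) where
  toFun u := (exists_weakDeriv u α).choose
  map_add' u v := (exists_weakDeriv (u + v) α).choose_spec.unique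
    ((exists_weakDeriv u α).choose_spec.add (exists_weakDeriv v α).choose_spec)
  map_smul' c u := (exists_weakDeriv (c • u) α).choose_spec.unique
    ((exists_weakDeriv u α).choose_spec.smul c)

theorem isWeakDeriv_weakDeriv (α : multiIndices N m) (u : SobolevSpace 𝕜 N p m) :
    IsWeakDeriv α.1 (toLp u) (weakDeriv α u) :=
  (exists_weakDeriv u α).choose_spec

variable (𝕜 N p m) in
/-- The family `(∂^α u)_{|α| ≤ m}` of all the derivatives of `u`, in the `ℓ^p`-sum of copies
of `L^p(ℝ^N)`. -/
def jet : SobolevSpace 𝕜 N p m →ₗ[𝕜] PiLp p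
    fun _ : multiIndices N m => Lp 𝕜 p (volume : Measure (EuclideanSpace ℝ (Fin N))) :=
  (WithLp.linearEquiv p 𝕜 (multiIndices N m → Lp 𝕜 p
    (volume : Measure (EuclideanSpace ℝ (Fin N))))).symm.toLinearMap ∘ₗ LinearMap.pi weakDeriv

theorem jet_apply (u : SobolevSpace 𝕜 N p m) (α : multiIndices N m) :
    jet 𝕜 N p m u α = weakDeriv α u := rfl

theorem jet_injective : Function.Injective (jet 𝕜 N p m) := by
  intro u v h
  let α : multiIndices N m := ⟨0, mem_multiIndices.mpr (by simp)⟩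
  have h0 : ∀ w : SobolevSpace 𝕜 N p m, weakDeriv α w = toLp w := fun w =>
    (isWeakDeriv_weakDeriv α w).unique (isWeakDeriv_zero_self _)
  apply toLp_injective
  rw [← h0 u, ← h0 v, ← jet_apply, ← jet_apply, h]

/-- The Sobolev norm is the norm of the family of derivatives; see `norm_def`. -/
instance : NormedAddCommGroup (SobolevSpace 𝕜 N p m) :=
  NormedAddCommGroup.induced _ _ (jet 𝕜 N p m) jet_injective

theorem norm_eq_norm_jet (u : SobolevSpace 𝕜 N p m) : ‖u‖ = ‖jet 𝕜 N p m u‖ := rfl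

/-- `‖u‖ = (∑_{|α| ≤ m} ‖∂^α u‖_{L^p}^p)^{1/p}`. -/
theorem norm_def (hp : p ≠ ⊤) (u : SobolevSpace 𝕜 N p m) :
    ‖u‖ = (∑ α : multiIndices N m, ‖weakDeriv α u‖ ^ p.toReal) ^ (1 / p.toReal) := by
  have h1 : (1 : ℝ≥0∞) ≤ p := Fact.out
  rw [norm_eq_norm_jet, PiLp.norm_eq_sum
    (ENNReal.toReal_pos (zero_lt_one.trans_le h1).ne' hp)]
  rfl

theorem norm_congr_weakDeriv {u v : SobolevSpace 𝕜 N p m}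
    (h : ∀ α : multiIndices N m, ‖weakDeriv α u‖ = ‖weakDeriv α v‖) : ‖u‖ = ‖v‖ := by
  by_cases hp : p = ⊤
  · subst hp
    rw [norm_eq_norm_jet, norm_eq_norm_jet, PiLp.norm_eq_ciSup, PiLp.norm_eq_ciSup]
    exact iSup_congr h
  · rw [norm_def hp, norm_def hp]
    simp only [h]

instance : NormedSpace 𝕜 (SobolevSpace 𝕜 N p m) where
  norm_smul_le c u := by
    rw [norm_eq_norm_jet, norm_eq_norm_jet, map_smul]
    exact norm_smul_le _ _

end SobolevSpace

/-- An integer vector `y ∈ ℤ^N` as a point of `ℝ^N`. -/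
def latticePoint (y : Fin N → ℤ) : EuclideanSpace ℝ (Fin N) :=
  WithLp.toLp 2 fun i => (y i : ℝ)

variable (𝕜 p) in
/-- The translation `u ↦ u(· - y)` on `L^p(ℝ^N)`, `y ∈ ℤ^N`. -/
def translationLp (y : Fin N → ℤ) :
    Lp 𝕜 p (volume : Measure (EuclideanSpace ℝ (Fin N))) →ₗᵢ[𝕜]
      Lp 𝕜 p (volume : Measure (EuclideanSpace ℝ (Fin N))) :=
  Lp.compMeasurePreservingₗᵢ 𝕜 (fun x => x - latticePoint y)
    (measurePreserving_sub_right volume (latticePoint y))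

theorem coeFn_translationLp (y : Fin N → ℤ)
    (u : Lp 𝕜 p (volume : Measure (EuclideanSpace ℝ (Fin N)))) :
    translationLp 𝕜 p y u =ᵐ[volume] fun x => u (x - latticePoint y) :=
  Lp.coeFn_compMeasurePreserving u (measurePreserving_sub_right volume (latticePoint y))

theorem IsWeakDeriv.translationLp {α : Fin N → ℕ}
    {u v : Lp 𝕜 p (volume : Measure (EuclideanSpace ℝ (Fin N)))} (h : IsWeakDeriv α u v)
    (y : Fin N → ℤ) : IsWeakDeriv α (translationLp 𝕜 p y u) (translationLp 𝕜 p y v) := by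
  have key : ∀ (a : Lp 𝕜 p (volume : Measure (EuclideanSpace ℝ (Fin N))))
      (ψ : EuclideanSpace ℝ (Fin N) → ℝ),
      ∫ x, ψ x • (_root_.translationLp 𝕜 p y a) x = ∫ x, ψ (x + latticePoint y) • a x := by
    intro a ψ
    rw [← integral_sub_right_eq_self (fun x => ψ (x + latticePoint y) • a x) (latticePoint y)]
    refine integral_congr_ae ?_
    filter_upwards [coeFn_translationLp y a] with x hx
    simp [hx]
  intro φ hφ
  have hφ' : IsTestFunction fun x => φ (x + latticePoint y) :=
    ⟨hφ.1.comp (contDiff_id.add contDiff_const),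
      hφ.2.comp_homeomorph (Homeomorph.addRight (latticePoint y))⟩
  have := h _ hφ'
  rw [multiDeriv_comp_add] at this
  rw [key, key, this]

namespace SobolevSpace

variable {m : ℕ}

theorem translationLp_toLp_mem (y : Fin N → ℤ) (u : SobolevSpace 𝕜 N p m) :
    translationLp 𝕜 p y (toLp u) ∈ sobolevSubmodule 𝕜 N p m := fun α hα => by
  obtain ⟨v, hv⟩ := toLp_mem u α hα
  exact ⟨_, hv.translationLp y⟩

theorem weakDeriv_translation (y : Fin N → ℤ) (u : SobolevSpace 𝕜 N p m)
    (α : multiIndices N m) :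
    weakDeriv α (ofLp _ (translationLp_toLp_mem y u)) = translationLp 𝕜 p y (weakDeriv α u) :=
  (isWeakDeriv_weakDeriv α _).unique ((isWeakDeriv_weakDeriv α u).translationLp y)

variable (𝕜 p m) in
/-- The translation `g[y] u = u(· - y)` on `W^{m,p}(ℝ^N)`, `y ∈ ℤ^N`. -/
def translation (y : Fin N → ℤ) : SobolevSpace 𝕜 N p m →ₗᵢ[𝕜] SobolevSpace 𝕜 N p m where
  toFun u := ofLp (translationLp 𝕜 p y (toLp u)) (translationLp_toLp_mem y u)
  map_add' u v := toLp_injective (map_add (translationLp 𝕜 p y) (toLp u) (toLp v))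
  map_smul' c u := toLp_injective (map_smul (translationLp 𝕜 p y) c (toLp u))
  norm_map' u := norm_congr_weakDeriv fun α =>
    (congrArg norm (weakDeriv_translation y u α)).trans ((translationLp 𝕜 p y).norm_map _)

theorem toLp_translation (y : Fin N → ℤ) (u : SobolevSpace 𝕜 N p m) :
    toLp (translation 𝕜 p m y u) = translationLp 𝕜 p y (toLp u) := rfl

theorem coeFn_translation (y : Fin N → ℤ) (u : SobolevSpace 𝕜 N p m) :
    toLp (translation 𝕜 p m y u) =ᵐ[volume] fun x => toLp u (x - latticePoint y) :=
  coeFn_translationLp y (toLp u)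

variable (𝕜 N p m) in
/-- The group `G[ℤ^N]` of integer translations, as a set of bounded operators on
`W^{m,p}(ℝ^N)`. -/
def latticeTranslations : Set (SobolevSpace 𝕜 N p m →L[𝕜] SobolevSpace 𝕜 N p m) :=
  Set.range fun y : Fin N → ℤ => (translation 𝕜 p m y).toContinuousLinearMap

end SobolevSpace

end Sobolev

end

/-!
The point is that translations by lattice vectors leaving every finite set tend operator-weakly to
zero. A sequence `g[y n]` which does not do so must therefore take some value `g[z]` infinitely
often, and along the corresponding constant subsequence all the required convergences, including
that of the adjoints and that of `g[y n] u n` for weakly null `u n`, are immediate.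

The weak convergence is first proved in `L^p(ℝ^N)`, without identifying the dual of `L^p`
(`tendsto_dual_translationLp_cofinite`). For a function of compact support, all but finitely many
translates have support disjoint from a given one. The `L^p` norm of a sum of `n` disjointly
supported translates is `n^{1/p}` times the norm of one of them, whereas a functional which is at
least `ε` in absolute value on each would be at least `n ε` on a suitable unimodular combination
(`tendsto_dual_cofinite_zero_of_disjoint`); for `p > 1` this bounds `n`. It carries over to
`W^{m,p}(ℝ^N)` because a functional there is a finite sum of functionals on `L^p` applied to the
derivatives, by Hahn–Banach (`SobolevSpace.exists_dual_eq_sum_weakDeriv`), and derivatives commute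
with translations.

Completeness of `W^{m,p}(ℝ^N)` holds since its image under the isometry `u ↦ (∂^α u)_α` is closed
(`SobolevSpace.isClosed_range_jetₗᵢ`).
-/

/-! ### Sequences with disjoint supports in `L^p` -/

section DisjointSupports

variable {α E : Type*} [MeasurableSpace α] {μ : Measure α} [NormedAddCommGroup E] {p : ℝ≥0∞}

theorem Lp_norm_add_rpow_of_disjoint [Fact (1 ≤ p)] (hp : p ≠ ⊤) {f g : Lp E p μ}
    (h : ∀ᵐ x ∂μ, f x = 0 ∨ g x = 0) :
    ‖f + g‖ ^ p.toReal = ‖f‖ ^ p.toReal + ‖g‖ ^ p.toReal := by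
  have hp0 : p ≠ 0 := (zero_lt_one.trans_le (Fact.out : 1 ≤ p)).ne'
  have hpos : 0 < p.toReal := ENNReal.toReal_pos hp0 hp
  have key : ∀ a : Lp E p μ, ENNReal.ofReal (‖a‖ ^ p.toReal) = ∫⁻ x, ‖a x‖ₑ ^ p.toReal ∂μ := by
    intro a
    rw [← ENNReal.ofReal_rpow_of_nonneg (norm_nonneg _) hpos.le, ofReal_norm, Lp.enorm_def,
      eLpNorm_eq_lintegral_rpow_enorm_toReal hp0 hp, ← ENNReal.rpow_mul,
      one_div_mul_cancel hpos.ne', ENNReal.rpow_one]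
  have hn : ∀ a : Lp E p μ, 0 ≤ ‖a‖ ^ p.toReal := fun a => Real.rpow_nonneg (norm_nonneg _) _
  rw [← ENNReal.ofReal_eq_ofReal_iff (hn _) (add_nonneg (hn _) (hn _)),
    ENNReal.ofReal_add (hn _) (hn _), key, key, key,
    ← lintegral_add_left' ((Lp.aestronglyMeasurable f).enorm.pow_const _)]
  refine lintegral_congr_ae ?_
  filter_upwards [h, Lp.coeFn_add f g] with x hx hadd
  rw [hadd, Pi.add_apply]
  rcases hx with hx | hx <;> simp [hx, hpos]

theorem Lp_norm_sum_rpow_of_disjoint [Fact (1 ≤ p)] (hp : p ≠ ⊤) {ι : Type*} (F : Finset ι)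
    (f : ι → Lp E p μ)
    (h : ∀ i ∈ F, ∀ j ∈ F, i ≠ j → ∀ᵐ x ∂μ, f i x = 0 ∨ f j x = 0) :
    ‖∑ i ∈ F, f i‖ ^ p.toReal = ∑ i ∈ F, ‖f i‖ ^ p.toReal := by
  classical
  have hpos : 0 < p.toReal :=
    ENNReal.toReal_pos (zero_lt_one.trans_le (Fact.out : 1 ≤ p)).ne' hp
  induction F using Finset.induction_on with
  | empty => simp [Real.zero_rpow hpos.ne']
  | insert a F ha ih =>
    rw [Finset.sum_insert ha, Finset.sum_insert ha,
      ← ih fun i hi j hj => h i (Finset.mem_insert_of_mem hi) j (Finset.mem_insert_of_mem hj)]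
    refine Lp_norm_add_rpow_of_disjoint hp ?_
    have h1 : ∀ᵐ x ∂μ, ∀ j ∈ F, f a x = 0 ∨ f j x = 0 :=
      (ae_ball_iff F.countable_toSet).mpr fun j hj => h a (Finset.mem_insert_self _ _) j
        (Finset.mem_insert_of_mem hj) (fun e => ha (e ▸ hj))
    filter_upwards [h1, Lp.coeFn_finsetSum F f] with x hx hsum
    by_cases h0 : f a x = 0
    · exact Or.inl h0
    · right
      rw [hsum, Finset.sum_apply]
      exact Finset.sum_eq_zero fun j hj => (hx j hj).resolve_left h0

end DisjointSupports

/-- A greedy choice: if every element is `r`-related, in both directions, to all but finitely many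
others, then an infinite set contains arbitrarily large finite subsets whose distinct elements are
`r`-related. -/
theorem Set.Infinite.exists_finset_card_pairwise {ι : Type*} {S : Set ι} (hS : S.Infinite)
    {r : ι → ι → Prop} (hr : ∀ i, {j | ¬ (r i j ∧ r j i)}.Finite) (n : ℕ) :
    ∃ F : Finset ι, F.card = n ∧ (↑F ⊆ S) ∧ ∀ i ∈ F, ∀ j ∈ F, i ≠ j → r i j := by
  classical
  induction n with
  | zero => exact ⟨∅, by simp⟩
  | succ n ih =>
    obtain ⟨F, hc, hFS, hF⟩ := ih
    have hfin : ((F : Set ι) ∪ ⋃ i ∈ F, {j | ¬ (r i j ∧ r j i)}).Finite :=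
      F.finite_toSet.union (F.finite_toSet.biUnion fun i _ => hr i)
    obtain ⟨a, haS, ha⟩ := (hS.sdiff hfin).nonempty
    simp only [Set.mem_union, Finset.mem_coe, Set.mem_iUnion, Set.mem_ofPred_eq, not_or,
      not_exists, not_not] at ha
    refine ⟨insert a F, by rw [Finset.card_insert_of_notMem ha.1, hc], ?_, ?_⟩
    · rw [Finset.coe_insert]
      exact Set.insert_subset haS hFS
    · intro i hi j hj hij
      rcases Finset.mem_insert.mp hi with rfl | hi' <;> rcases Finset.mem_insert.mp hj with rfl | hj'
      · exact absurd rfl hij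
      · exact (ha.2 j hj').2
      · exact (ha.2 i hi').1
      · exact hF i hi' j hj' hij

/-- If each `f i` has support disjoint from that of all but finitely many `f j`, then a functional
`ψ` tends to zero along the bounded family `f`: were `|ψ (f i)| ≥ ε` for infinitely many `i`, then
a unimodular combination of `n` disjointly supported `f i` would have norm `O(n^{1/p})` and `ψ`-value
at least `n ε`, which is impossible for large `n` as `p > 1`. -/
theorem tendsto_dual_cofinite_zero_of_disjoint {α 𝕜 ι : Type*} [MeasurableSpace α]
    {μ : Measure α} [RCLike 𝕜] {p : ℝ≥0∞} [Fact (1 ≤ p)] (hp₁ : 1 < p) (hp : p ≠ ⊤)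
    {f : ι → Lp 𝕜 p μ} {C : ℝ} (hC : ∀ i, ‖f i‖ ≤ C)
    (hf : ∀ i, {j | ¬ ∀ᵐ x ∂μ, f i x = 0 ∨ f j x = 0}.Finite) (ψ : StrongDual 𝕜 (Lp 𝕜 p μ)) :
    Tendsto (fun i => ψ (f i)) cofinite (𝓝 0) := by
  have hr1 : 1 < p.toReal := by
    rw [← ENNReal.toReal_one]
    exact (ENNReal.toReal_lt_toReal ENNReal.one_ne_top hp).mpr hp₁
  have hpos : 0 < p.toReal := zero_lt_one.trans hr1
  rw [Metric.tendsto_nhds]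
  intro ε hε
  rw [eventually_cofinite]
  by_contra hS
  replace hS : {i | ¬ dist (ψ (f i)) 0 < ε}.Infinite := hS
  have hgrow : ∀ n : ℕ, 0 < n → (n : ℝ) ^ (p.toReal - 1) ≤ (‖ψ‖ * C / ε) ^ p.toReal := by
    intro n hn
    have hn' : (0 : ℝ) < n := Nat.cast_pos.mpr hn
    obtain ⟨F, hcard, hFS, hF⟩ := hS.exists_finset_card_pairwise
      (r := fun i j => ∀ᵐ x ∂μ, f i x = 0 ∨ f j x = 0)
      (fun i => (hf i).subset fun j hj hij => hj ⟨hij, hij.mono fun x hx => hx.symm⟩) n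
    have hF0 : ∀ i ∈ F, ε ≤ ‖ψ (f i)‖ := fun i hi => by simpa using hFS hi
    have hC0 : 0 ≤ C := by
      obtain ⟨i, -⟩ := Finset.card_pos.mp (hcard ▸ hn)
      exact (norm_nonneg _).trans (hC i)
    -- Unimodular coefficients that make all the values of `ψ` positive.
    let c : ι → 𝕜 := fun i => (starRingEnd 𝕜) (ψ (f i)) / (‖ψ (f i)‖ : 𝕜)
    have hc : ∀ i ∈ F, ‖c i‖ = 1 := fun i hi => by
      have h0 : ‖ψ (f i)‖ ≠ 0 := (hε.trans_le (hF0 i hi)).ne'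
      simp only [c, norm_div, RCLike.norm_conj, RCLike.norm_ofReal, abs_norm]
      exact div_self h0
    have hcψ : ∀ i ∈ F, c i * ψ (f i) = (‖ψ (f i)‖ : 𝕜) := fun i hi => by
      have h0 : (‖ψ (f i)‖ : 𝕜) ≠ 0 :=
        RCLike.ofReal_ne_zero.mpr (hε.trans_le (hF0 i hi)).ne'
      simp only [c]
      rw [div_mul_eq_mul_div, RCLike.conj_mul, sq, mul_div_assoc, div_self h0, mul_one]
    have hlow : n * ε ≤ ‖ψ (∑ i ∈ F, c i • f i)‖ := by
      have : ψ (∑ i ∈ F, c i • f i) = ((∑ i ∈ F, ‖ψ (f i)‖ : ℝ) : 𝕜) := by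
        rw [map_sum, RCLike.ofReal_sum]
        exact Finset.sum_congr rfl fun i hi => by rw [map_smul, smul_eq_mul, hcψ i hi]
      rw [this, RCLike.norm_ofReal]
      refine le_trans ?_ (le_abs_self _)
      rw [← hcard, ← nsmul_eq_mul]
      exact Finset.card_nsmul_le_sum _ _ _ hF0
    have hup : ‖∑ i ∈ F, c i • f i‖ ^ p.toReal ≤ n * C ^ p.toReal := by
      rw [Lp_norm_sum_rpow_of_disjoint hp, ← hcard, ← nsmul_eq_mul]
      · refine Finset.sum_le_card_nsmul _ _ _ fun i hi => ?_
        rw [norm_smul, hc i hi, one_mul]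
        exact Real.rpow_le_rpow (norm_nonneg _) (hC i) hpos.le
      · intro i hi j hj hij
        filter_upwards [hF i hi j hj hij, Lp.coeFn_smul (c i) (f i), Lp.coeFn_smul (c j) (f j)]
          with x hx h1 h2
        rw [h1, h2, Pi.smul_apply, Pi.smul_apply]
        exact hx.imp (fun h => by rw [h, smul_zero]) fun h => by rw [h, smul_zero]
    have h3 : (n * ε) ^ p.toReal ≤ ‖ψ‖ ^ p.toReal * (n * C ^ p.toReal) :=
      calc (n * ε) ^ p.toReal ≤ (‖ψ‖ * ‖∑ i ∈ F, c i • f i‖) ^ p.toReal :=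
            Real.rpow_le_rpow (by positivity) (hlow.trans (ψ.le_opNorm _)) hpos.le
        _ = ‖ψ‖ ^ p.toReal * ‖∑ i ∈ F, c i • f i‖ ^ p.toReal :=
            Real.mul_rpow (norm_nonneg _) (norm_nonneg _)
        _ ≤ _ := by gcongr
    rw [Real.mul_rpow hn'.le hε.le] at h3
    rw [Real.div_rpow (by positivity) hε.le, Real.mul_rpow (norm_nonneg _) hC0,
      Real.rpow_sub_one hn'.ne', div_le_div_iff₀ hn' (by positivity)]
    linarith
  have hlim : Tendsto (fun n : ℕ => (n : ℝ) ^ (p.toReal - 1)) atTop atTop :=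
    (tendsto_rpow_atTop (sub_pos.mpr hr1)).comp tendsto_natCast_atTop_atTop
  obtain ⟨n, hn, hn0⟩ :=
    ((hlim.eventually_gt_atTop _).and (eventually_gt_atTop 0)).exists
  exact (hgrow n hn0).not_gt hn

/-! ### Integer translations of `L^p` -/

section Translations

variable {𝕜 : Type*} [RCLike 𝕜] {N : ℕ} {p : ℝ≥0∞} [Fact (1 ≤ p)]

theorem latticePoint_zero : latticePoint (0 : Fin N → ℤ) = 0 := by
  ext i; simp [latticePoint]

theorem latticePoint_add (y z : Fin N → ℤ) :
    latticePoint (y + z) = latticePoint y + latticePoint z := by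
  ext i; simp [latticePoint]

theorem Bornology.IsBounded.finite_preimage_latticePoint
    {s : Set (EuclideanSpace ℝ (Fin N))} (hs : Bornology.IsBounded s) :
    (latticePoint ⁻¹' s).Finite := by
  obtain ⟨R, hR⟩ := hs.exists_norm_le
  refine ((isCompact_closedBall (0 : Fin N → ℤ) R).finite_of_discrete).subset fun y hy => ?_
  have h := hR _ hy
  rw [mem_closedBall_zero_iff, pi_norm_le_iff_of_nonneg ((norm_nonneg _).trans h)]
  intro i
  refine le_trans ?_ ((PiLp.norm_apply_le (latticePoint y) i).trans h)
  simp [latticePoint, Int.norm_eq_abs]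

theorem translationLp_zero (u : Lp 𝕜 p (volume : Measure (EuclideanSpace ℝ (Fin N)))) :
    translationLp 𝕜 p 0 u = u := by
  refine Lp.ext ?_
  filter_upwards [coeFn_translationLp 0 u] with x hx
  rw [hx, latticePoint_zero, sub_zero]

theorem translationLp_add (y z : Fin N → ℤ)
    (u : Lp 𝕜 p (volume : Measure (EuclideanSpace ℝ (Fin N)))) :
    translationLp 𝕜 p (y + z) u = translationLp 𝕜 p y (translationLp 𝕜 p z u) := by
  refine Lp.ext ?_
  filter_upwards [coeFn_translationLp (y + z) u, coeFn_translationLp y (translationLp 𝕜 p z u),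
    (measurePreserving_sub_right volume (latticePoint y)).quasiMeasurePreserving.ae
      (coeFn_translationLp z u)] with x h1 h2 h3
  rw [h1, h2, h3, latticePoint_add, sub_sub]

/-- For fixed `u ∈ L^p(ℝ^N)`, `1 < p < ∞`, the translates `u(· - y)` tend weakly to zero as `y ∈ ℤ^N`
leaves every finite set. By density, `u` may be replaced by a continuous function of compact
support. -/
theorem tendsto_dual_translationLp_cofinite (hp₁ : 1 < p) (hp : p ≠ ⊤)
    (ψ : StrongDual 𝕜 (Lp 𝕜 p (volume : Measure (EuclideanSpace ℝ (Fin N)))))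
    (u : Lp 𝕜 p (volume : Measure (EuclideanSpace ℝ (Fin N)))) :
    Tendsto (fun y => ψ (translationLp 𝕜 p y u)) cofinite (𝓝 0) := by
  rw [Metric.tendsto_nhds]
  intro ε hε
  obtain ⟨δ, hδ, hδε⟩ : ∃ δ : ℝ, 0 < δ ∧ ‖ψ‖ * δ < ε / 2 := by
    refine ⟨ε / 2 / (‖ψ‖ + 1), by positivity, ?_⟩
    rw [mul_div_assoc', div_lt_iff₀ (by positivity)]
    nlinarith
  obtain ⟨g, hgK, hgu, -, hg⟩ := (Lp.memLp u).exists_hasCompactSupport_eLpNorm_sub_le hp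
    (ENNReal.ofReal_pos.mpr hδ).ne'
  have hgu' : ‖u - hg.toLp g‖ ≤ δ := by
    rw [← ENNReal.ofReal_le_ofReal_iff hδ.le, ofReal_norm, Lp.enorm_def]
    refine le_of_eq_of_le (eLpNorm_congr_ae ?_) hgu
    filter_upwards [Lp.coeFn_sub u (hg.toLp g), hg.coeFn_toLp] with x h1 h2
    rw [h1, Pi.sub_apply, Pi.sub_apply, h2]
  have hcoe : ∀ y, translationLp 𝕜 p y (hg.toLp g) =ᵐ[volume] fun x => g (x - latticePoint y) := by
    intro y
    filter_upwards [coeFn_translationLp y (hg.toLp g),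
      (measurePreserving_sub_right volume (latticePoint y)).quasiMeasurePreserving.ae
        hg.coeFn_toLp] with x h1 h2
    rw [h1, h2]
  have hlim := tendsto_dual_cofinite_zero_of_disjoint hp₁ hp
    (f := fun y => translationLp 𝕜 p y (hg.toLp g)) (C := ‖hg.toLp g‖)
    (fun y => ((translationLp 𝕜 p y).norm_map _).le) (fun y => ?_) ψ
  · filter_upwards [(Metric.tendsto_nhds.mp hlim) (ε / 2) (half_pos hε)] with y hy
    rw [dist_zero_right] at hy ⊢
    have h1 : ‖ψ (translationLp 𝕜 p y (u - hg.toLp g))‖ ≤ ‖ψ‖ * δ :=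
      (ψ.le_opNorm _).trans (by rw [LinearIsometry.norm_map]; gcongr)
    have h2 : ψ (translationLp 𝕜 p y u) = ψ (translationLp 𝕜 p y (u - hg.toLp g)) +
        ψ (translationLp 𝕜 p y (hg.toLp g)) := by rw [← map_add, ← map_add, sub_add_cancel]
    rw [h2]
    linarith [norm_add_le (ψ (translationLp 𝕜 p y (u - hg.toLp g)))
      (ψ (translationLp 𝕜 p y (hg.toLp g)))]
  · -- Overlapping translates of `g` differ by a point of the bounded set `tsupport g - tsupport g`.
    have hb : Bornology.IsBounded
        ((fun q : EuclideanSpace ℝ (Fin N) × EuclideanSpace ℝ (Fin N) =>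
          latticePoint y + q.1 - q.2) '' (tsupport g ×ˢ tsupport g)) :=
      ((hgK.isCompact.prod hgK.isCompact).image (by fun_prop)).isBounded
    refine hb.finite_preimage_latticePoint.subset fun z hz => ?_
    by_contra hz'
    refine hz ?_
    filter_upwards [hcoe y, hcoe z] with x h1 h2
    rw [h1, h2]
    by_contra! hne
    refine hz' ⟨(x - latticePoint y, x - latticePoint z),
      ⟨subset_tsupport _ hne.1, subset_tsupport _ hne.2⟩, ?_⟩
    simp

end Translations

/-! ### Completeness of the Sobolev space -/

section Completeness

variable {𝕜 : Type*} [RCLike 𝕜] {N : ℕ} {p : ℝ≥0∞} [Fact (1 ≤ p)] {m : ℕ}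

/-- By Hölder's inequality, since a test function lies in `L^q` for the conjugate exponent `q`. -/
theorem IsTestFunction.continuous_integral_smul {φ : EuclideanSpace ℝ (Fin N) → ℝ}
    (h : IsTestFunction φ) :
    Continuous fun u : Lp 𝕜 p (volume : Measure (EuclideanSpace ℝ (Fin N))) =>
      ∫ x, φ x • u x := by
  have : Fact (1 ≤ p.conjExponent) := ⟨ENNReal.HolderConjugate.one_le p.conjExponent p⟩
  have hφ : MemLp φ p.conjExponent volume := h.1.continuous.memLp_of_hasCompactSupport h.2
  refine (((ContinuousLinearMap.lsmul ℝ ℝ : ℝ →L[ℝ] 𝕜 →L[ℝ] 𝕜).lpPairing volume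
    p.conjExponent p) (hφ.toLp φ)).continuous.congr fun u => ?_
  rw [ContinuousLinearMap.lpPairing_eq_integral]
  refine integral_congr_ae ?_
  filter_upwards [hφ.coeFn_toLp] with x hx
  rw [hx, ContinuousLinearMap.lsmul_apply]

namespace SobolevSpace

variable (𝕜 N p m) in
/-- The derivative map `jet` as a linear isometry of `W^{m,p}(ℝ^N)` into a finite `ℓ^p`-sum of
copies of `L^p(ℝ^N)`. -/
noncomputable def jetₗᵢ : SobolevSpace 𝕜 N p m →ₗᵢ[𝕜] PiLp p
    fun _ : multiIndices N m => Lp 𝕜 p (volume : Measure (EuclideanSpace ℝ (Fin N))) where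
  toLinearMap := jet 𝕜 N p m
  norm_map' u := (norm_eq_norm_jet u).symm

theorem jetₗᵢ_apply (u : SobolevSpace 𝕜 N p m) (α : multiIndices N m) :
    jetₗᵢ 𝕜 N p m u α = weakDeriv α u := rfl

theorem weakDeriv_zero_index {α : multiIndices N m} (hα : α.1 = 0) (u : SobolevSpace 𝕜 N p m) :
    weakDeriv α u = toLp u := by
  refine (isWeakDeriv_weakDeriv α u).unique ?_
  rw [hα]
  exact isWeakDeriv_zero_self _

/-- A family `(w_α)` is a family of derivatives iff each `w_α` is the distributional derivative of
`w_0`, and for each test function this is an equation between continuous functions of `w`. -/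
theorem isClosed_range_jetₗᵢ : IsClosed (Set.range (jetₗᵢ 𝕜 N p m)) := by
  let o : multiIndices N m := ⟨0, mem_multiIndices.mpr (by simp)⟩
  have hr : Set.range (jetₗᵢ 𝕜 N p m) =
      {w | ∀ α : multiIndices N m, IsWeakDeriv α.1 (w o) (w α)} := by
    ext w
    constructor
    · rintro ⟨u, rfl⟩ α
      rw [jetₗᵢ_apply, jetₗᵢ_apply, weakDeriv_zero_index rfl]
      exact isWeakDeriv_weakDeriv α u
    · intro hw
      refine ⟨ofLp (w o) fun α hα => ⟨w ⟨α, mem_multiIndices.mpr hα⟩,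
        hw ⟨α, mem_multiIndices.mpr hα⟩⟩, ?_⟩
      ext1 α
      rw [jetₗᵢ_apply]
      exact (isWeakDeriv_weakDeriv α _).unique (hw α)
  have hev : ∀ α : multiIndices N m, Continuous fun w : PiLp p fun _ : multiIndices N m =>
      Lp 𝕜 p (volume : Measure (EuclideanSpace ℝ (Fin N))) => w α :=
    fun α => PiLp.continuous_apply _ _ α
  rw [hr]
  simp only [IsWeakDeriv, Set.ofPred_forall]
  refine isClosed_iInter fun α => isClosed_iInter fun φ => isClosed_iInter fun hφ => ?_
  exact isClosed_eq ((hφ.multiDeriv α.1).continuous_integral_smul.comp (hev o))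
    (continuous_const.mul (hφ.continuous_integral_smul.comp (hev α)))

instance : CompleteSpace (SobolevSpace 𝕜 N p m) :=
  (completeSpace_iff_isComplete_range (jetₗᵢ 𝕜 N p m).isometry.isUniformInducing).mpr
    isClosed_range_jetₗᵢ.isComplete

end SobolevSpace

end Completeness

/-! ### Integer translations of the Sobolev space -/

namespace SobolevSpace

variable {𝕜 : Type*} [RCLike 𝕜] {N : ℕ} {p : ℝ≥0∞} [Fact (1 ≤ p)] {m : ℕ}

/-- Bounded functionals on `W^{m,p}(ℝ^N)` come from functionals on `L^p(ℝ^N)` applied to the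
derivatives: extend from the range of the isometry `jetₗᵢ` by Hahn–Banach. -/
theorem exists_dual_eq_sum_weakDeriv (φ : StrongDual 𝕜 (SobolevSpace 𝕜 N p m)) :
    ∃ ψ : multiIndices N m →
        StrongDual 𝕜 (Lp 𝕜 p (volume : Measure (EuclideanSpace ℝ (Fin N)))),
      ∀ u, φ u = ∑ α, ψ α (weakDeriv α u) := by
  classical
  let J := jetₗᵢ 𝕜 N p m
  obtain ⟨Φ, hΦ, -⟩ := exists_extension_norm_eq (LinearMap.range J.toLinearMap)
    (φ.comp (J.equivRange.symm.toContinuousLinearEquiv : _ →L[𝕜] SobolevSpace 𝕜 N p m))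
  let L := Φ.comp ((PiLp.continuousLinearEquiv p 𝕜 fun _ : multiIndices N m =>
    Lp 𝕜 p (volume : Measure (EuclideanSpace ℝ (Fin N)))).symm.toContinuousLinearMap)
  refine ⟨fun α => L.comp (ContinuousLinearMap.single 𝕜
    (fun _ => Lp 𝕜 p (volume : Measure (EuclideanSpace ℝ (Fin N)))) α), fun u => ?_⟩
  have h1 : φ u = Φ (J u) := by
    have := hΦ (J.equivRange u)
    simpa using this.symm
  have h2 := ContinuousLinearMap.sum_comp_single 𝕜 _ L (fun α => weakDeriv α u)
  rw [h1]
  exact h2.symm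

theorem translation_zero :
    (translation 𝕜 p m (0 : Fin N → ℤ)).toContinuousLinearMap = ContinuousLinearMap.id 𝕜 _ :=
  ContinuousLinearMap.ext fun u => toLp_injective (translationLp_zero (toLp u))

theorem translation_add (y z : Fin N → ℤ) :
    (translation 𝕜 p m (y + z)).toContinuousLinearMap =
      (translation 𝕜 p m y).toContinuousLinearMap.comp
        (translation 𝕜 p m z).toContinuousLinearMap :=
  ContinuousLinearMap.ext fun u => toLp_injective (translationLp_add y z (toLp u))

theorem isIsometryGroup_latticeTranslations :
    IsIsometryGroup (latticeTranslations 𝕜 N p m) where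
  one_mem := ⟨0, translation_zero⟩
  comp_mem := by
    rintro _ ⟨y, rfl⟩ _ ⟨z, rfl⟩
    exact ⟨y + z, translation_add y z⟩
  exists_inv := by
    rintro _ ⟨y, rfl⟩
    refine ⟨_, ⟨-y, rfl⟩, ?_, ?_⟩
    · rw [← translation_add, add_neg_cancel, translation_zero]
    · rw [← translation_add, neg_add_cancel, translation_zero]
  isometry := by
    rintro _ ⟨y, rfl⟩
    exact (translation 𝕜 p m y).isometry
  bijective := by
    rintro _ ⟨y, rfl⟩
    refine ⟨(translation 𝕜 p m y).injective, fun u => ⟨translation 𝕜 p m (-y) u, ?_⟩⟩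
    have h := DFunLike.congr_fun (translation_add (𝕜 := 𝕜) (p := p) (m := m) y (-y)) u
    rw [add_neg_cancel, translation_zero] at h
    exact h.symm

theorem opWeaklyTendsto_translation_zero (hp₁ : 1 < p) (hp : p ≠ ⊤) {y : ℕ → Fin N → ℤ}
    (hy : Tendsto y atTop cofinite) :
    OpWeaklyTendsto (fun n => (translation 𝕜 p m (y n)).toContinuousLinearMap) 0 := by
  intro u φ
  obtain ⟨ψ, hψ⟩ := exists_dual_eq_sum_weakDeriv φ
  have h : Tendsto (fun n => ∑ α, ψ α (translationLp 𝕜 p (y n) (weakDeriv α u))) atTop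
      (𝓝 (∑ _α : multiIndices N m, 0)) :=
    tendsto_finsetSum _ fun α _ => (tendsto_dual_translationLp_cofinite hp₁ hp (ψ α) _).comp hy
  rw [Finset.sum_const_zero] at h
  rw [_root_.zero_apply, map_zero]
  refine h.congr fun n => ?_
  rw [hψ]
  exact Finset.sum_congr rfl fun α _ => congrArg (ψ α) (weakDeriv_translation (y n) u α).symm

/-- The integer translations form a discrete group: a sequence that is not operator-weakly null
takes one of its values infinitely often. -/
theorem exists_subseq_eq_of_not_opWeaklyTendsto (hp₁ : 1 < p) (hp : p ≠ ⊤) {y : ℕ → Fin N → ℤ}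
    (hy : ¬ OpWeaklyTendsto (fun n => (translation 𝕜 p m (y n)).toContinuousLinearMap) 0) :
    ∃ k : ℕ → ℕ, StrictMono k ∧ ∃ z, ∀ j, y (k j) = z := by
  obtain ⟨z, hz⟩ : ∃ z, ∃ᶠ n in atTop, y n = z := by
    by_contra! h
    refine hy (opWeaklyTendsto_translation_zero hp₁ hp ?_)
    rw [← Nat.cofinite_eq_atTop]
    refine Tendsto.cofinite_of_finite_preimage_singleton fun z => ?_
    have hfin := h z
    rw [← Nat.cofinite_eq_atTop, eventually_cofinite] at hfin
    exact hfin.subset fun n hn => not_not.mpr hn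
  obtain ⟨k, hk, hkz⟩ := extraction_of_frequently_atTop hz
  exact ⟨k, hk, z, hkz⟩

end SobolevSpace

theorem proposition3p3 {𝕜 : Type*} [RCLike 𝕜] (N m : ℕ) (p : ℝ≥0∞) [Fact (1 ≤ p)]
    (hp₁ : 1 < p) (hp : p ≠ ⊤) :
    IsDislocationSpace (SobolevSpace.latticeTranslations 𝕜 N p m) ∧
    ∀ y : ℕ → Fin N → ℤ,
      ¬ OpWeaklyTendsto
          (fun n => (SobolevSpace.translation 𝕜 p m (y n)).toContinuousLinearMap) 0 →
      ∃ k : ℕ → ℕ, StrictMono k ∧ ∃ z : Fin N → ℤ,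
        OpStronglyTendsto
          (fun j => (SobolevSpace.translation 𝕜 p m (y (k j))).toContinuousLinearMap)
          (SobolevSpace.translation 𝕜 p m z).toContinuousLinearMap ∧
        OpStronglyTendsto
          (fun j => dualAdjoint
            (SobolevSpace.translation 𝕜 p m (y (k j))).toContinuousLinearMap)
          (dualAdjoint (SobolevSpace.translation 𝕜 p m z).toContinuousLinearMap) := by
  have hconst : ∀ g : ℕ → SobolevSpace 𝕜 N p m →L[𝕜] SobolevSpace 𝕜 N p m,
      (∀ n, g n ∈ SobolevSpace.latticeTranslations 𝕜 N p m) → ¬ OpWeaklyTendsto g 0 →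
      ∃ k : ℕ → ℕ, StrictMono k ∧ ∃ A, ∀ j, g (k j) = A := by
    intro g hg hg0
    choose y hy using hg
    obtain rfl : (fun n => (SobolevSpace.translation 𝕜 p m (y n)).toContinuousLinearMap) = g :=
      funext hy
    obtain ⟨k, hk, z, hz⟩ :=
      SobolevSpace.exists_subseq_eq_of_not_opWeaklyTendsto hp₁ hp hg0
    exact ⟨k, hk, (SobolevSpace.translation 𝕜 p m z).toContinuousLinearMap,
      fun j => by simp only [hz j]⟩
  refine ⟨⟨inferInstance, SobolevSpace.isIsometryGroup_latticeTranslations, ?_, ?_⟩, ?_⟩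
  · intro g hg hg0
    obtain ⟨k, hk, A, hA⟩ := hconst g hg hg0
    refine ⟨k, hk, A, fun u => ?_⟩
    simp only [hA]
    exact tendsto_const_nhds
  · intro g hg hg0 u hu
    obtain ⟨k, hk, A, hA⟩ := hconst g hg hg0
    refine ⟨k, hk, fun φ => ?_⟩
    simp only [hA]
    have h := (hu (φ.comp A)).comp hk.tendsto_atTop
    rw [map_zero] at h ⊢
    exact h
  · intro y hy
    obtain ⟨k, hk, z, hz⟩ :=
      SobolevSpace.exists_subseq_eq_of_not_opWeaklyTendsto hp₁ hp hy
    refine ⟨k, hk, z, fun u => ?_, fun φ => ?_⟩ <;> simp only [hz] <;> exact tendsto_const_nhds
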